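/- Let $T>0$ and let $f:\mathbb{R}\times[0,\infty)\to\mathbb{R}$ be locally H\"older continuous, of class $C^1$ with respect to $u$, and $T$-periodic in $t$, i.e. $f(t+T,u)=f(t,u)$ for all $t\in\mathbb{R}$, $u\ge 0$. Assume that $\partial_u f(t,u)$ is locally Lipschitz continuous in $u$ uniformly for $t$. Let $\mathcal{X}_{per}$ be the set of nonnegative $T$-periodic solutions $p$ of $p_t=f(t,p)$, $t\in\mathbb{R}$. For $a\ge 0$ let $h(t;a)$ be the maximal (nonnegative) solution of $h_t=f(t,h)$ for $t>0$, $h(0)=a$. Call $h(\cdot;a)$ $T$-monotone nondecreasing if either it is global and $h(t+T;a)=h(t;a)$ for all $t\ge0$, or it exists on $[0,T]$ and $h(t+T;a)>h(t;a)$ for all $t\ge 0$ for which $h(t+T;a)$ exists. Let $\mathcal{Y}_{per}$ be the set of those $p\in\mathcal{X}_{per}$ for which there is $\varepsilon>0$ such that $h(\cdot;a)$ is $T$-monotone nondecreasing for every $a\in(p(0),p(0)+\varepsilon)$. Let $p\in\mathcal{X}_{per}$. Suppose that the equation $$U_t=U_{xx}+f(t,U),\qquad x\in\mathbb{R},\ t\in\mathbb{R},$$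 has a nonnegative classical solution $U(x,t)$ that is $T$-periodic in $t$, symmetrically decreasing (there is $x_0\in\mathbb{R}$ with $U(2x_0-x,t)=U(x,t)$ for all $x,t\in\mathbb{R}$ and $\partial_xU(x,t)<0$ for all $x>x_0$, $t\in\mathbb{R}$), and based at $p$ (that is, $\lim_{|x|\to\infty}U(x,t)=p(t)$ for every $t\in\mathbb{R}$). Then $p\notin\mathcal{Y}_{per}$. -/

import Mathlib

open Set Filter Topology
open scoped NNReal

namespace PeriodicRD

/-- Only the values `f t u` with `u ≥ 0` are constrained (and only those are used below):
`f` is a nonlinearity on `ℝ × [0, ∞)`, locally Hölder continuous, `C¹` in `u`, `T`-periodic in `t`,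
and `∂ᵤ f` is locally Lipschitz in `u` uniformly in `t`.
At `u = 0` the derivative in `u` is one-sided. -/
structure IsAdmissible (f : ℝ → ℝ → ℝ) (T : ℝ) : Prop where
  holder : ∀ R : ℝ, ∃ C α : ℝ≥0, 0 < α ∧ α ≤ 1 ∧
    HolderOnWith C α (fun z : ℝ × ℝ => f z.1 z.2) (Icc (-R) R ×ˢ Icc 0 R)
  contDiff : ∀ t : ℝ, ContDiffOn ℝ 1 (f t) (Ici 0)
  periodic : ∀ t u : ℝ, 0 ≤ u → f (t + T) u = f t u
  lipschitz : ∀ R : ℝ, ∃ L : ℝ≥0, ∀ t : ℝ,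
    LipschitzOnWith L (fun u => derivWithin (f t) (Ici 0) u) (Icc 0 R)

/-- `U x t` is a nonnegative classical (`C^{2,1}`) entire solution of
`U_t = U_xx + f(t, U)` on `ℝ × ℝ`. -/
structure IsEntireSolution (f : ℝ → ℝ → ℝ) (U : ℝ → ℝ → ℝ) : Prop where
  nonneg : ∀ x t : ℝ, 0 ≤ U x t
  contDiff_x : ∀ t : ℝ, ContDiff ℝ 2 (fun x => U x t)
  contDiff_t : ∀ x : ℝ, ContDiff ℝ 1 (fun t => U x t)
  continuous : Continuous (fun z : ℝ × ℝ => U z.1 z.2)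
  continuous_x : Continuous (fun z : ℝ × ℝ => deriv (fun x => U x z.2) z.1)
  continuous_xx : Continuous (fun z : ℝ × ℝ => iteratedDeriv 2 (fun x => U x z.2) z.1)
  continuous_t : Continuous (fun z : ℝ × ℝ => deriv (fun t => U z.1 t) z.2)
  equation : ∀ x t : ℝ,
    deriv (fun s => U x s) t = iteratedDeriv 2 (fun y => U y t) x + f t (U x t)

/-- `U` is symmetrically decreasing with respect to `x₀`. -/
def IsSymmDecreasingAbout (U : ℝ → ℝ → ℝ) (x₀ : ℝ) : Prop :=
  (∀ x t : ℝ, U (2 * x₀ - x) t = U x t) ∧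
    ∀ x t : ℝ, x₀ < x → deriv (fun y => U y t) x < 0

/-- `U` is symmetrically decreasing (with respect to some point). -/
def IsSymmDecreasing (U : ℝ → ℝ → ℝ) : Prop :=
  ∃ x₀ : ℝ, IsSymmDecreasingAbout U x₀

/-- `p` is the base of `U`: `p t` is the limit of `U x t` as `|x| → ∞`. -/
def IsBase (U : ℝ → ℝ → ℝ) (p : ℝ → ℝ) : Prop :=
  ∀ t : ℝ, Tendsto (fun x => U x t) atTop (𝓝 (p t)) ∧ Tendsto (fun x => U x t) atBot (𝓝 (p t))

/-- `h` restricted to `[0, τ)` is a (nonnegative) solution of `h' = f(t, h)`, `h(0) = a`. -/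
def IsInitialSolution (f : ℝ → ℝ → ℝ) (a : ℝ) (h : ℝ → ℝ) (τ : EReal) : Prop :=
  0 < τ ∧ h 0 = a ∧ ∀ t : ℝ, 0 ≤ t → (t : EReal) < τ →
    0 ≤ h t ∧ HasDerivWithinAt h (f t (h t)) (Ici 0) t

/-- `h` on `[0, τ)` is the maximal solution `h(·; a)` of `h' = f(t, h)`, `h(0) = a`. -/
def IsMaximalSolution (f : ℝ → ℝ → ℝ) (a : ℝ) (h : ℝ → ℝ) (τ : EReal) : Prop :=
  IsInitialSolution f a h τ ∧
    ∀ (g : ℝ → ℝ) (σ : EReal), IsInitialSolution f a g σ → σ ≤ τ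

/-- `h(·; a)` is `T`-periodic; in particular it is global. -/
def IsTPeriodic (f : ℝ → ℝ → ℝ) (T a : ℝ) : Prop :=
  ∃ h : ℝ → ℝ, IsMaximalSolution f a h ⊤ ∧ ∀ t : ℝ, 0 ≤ t → h (t + T) = h t

/-- `h(·; a)` is `T`-monotone increasing. It has to exist on `[0, T]`, but need not be global:
the inequality is required as long as `h(t + T; a)` exists. -/
def IsTMonotoneIncreasing (f : ℝ → ℝ → ℝ) (T a : ℝ) : Prop :=
  ∃ (h : ℝ → ℝ) (τ : EReal), IsMaximalSolution f a h τ ∧ (T : EReal) < τ ∧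
    ∀ t : ℝ, 0 ≤ t → ((t + T : ℝ) : EReal) < τ → h t < h (t + T)

/-- `h(·; a)` is `T`-monotone nondecreasing. -/
def IsTMonotoneNondecreasing (f : ℝ → ℝ → ℝ) (T a : ℝ) : Prop :=
  IsTPeriodic f T a ∨ IsTMonotoneIncreasing f T a

/-- The nonnegative `T`-periodic solutions of `p' = f(t, p)` on `ℝ`. -/
def XPer (f : ℝ → ℝ → ℝ) (T : ℝ) : Set (ℝ → ℝ) :=
  {p | (∀ t : ℝ, 0 ≤ p t) ∧ (∀ t : ℝ, p (t + T) = p t) ∧ ∀ t : ℝ, HasDerivAt p (f t (p t)) t}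

/-- The `p ∈ XPer` such that `h(·; a)` is `T`-monotone nondecreasing for all `a` slightly
above `p(0)`. -/
def YPer (f : ℝ → ℝ → ℝ) (T : ℝ) : Set (ℝ → ℝ) :=
  {p | p ∈ XPer f T ∧ ∃ ε : ℝ, 0 < ε ∧
    ∀ a ∈ Ioo (p 0) (p 0 + ε), IsTMonotoneNondecreasing f T a}

end PeriodicRD

/-!
Let `H a t` be the solution of `h' = f(t, h)`, `h(0) = a`, and suppose that it exists on `[0, T]`
and satisfies `a ≤ H a T` for all `a ∈ [p 0, b₁]`, as `p ∈ YPer` provides. For large `x` the profile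
lies between `p` and `H b₁`, so it can be pulled back along the flow: `U x t = H (W x t) t` with
`W x t ∈ [p 0, b₁]`. Since `U` is periodic in `t`, the condition on `H a T` says `W x T ≤ W x 0`.

Any increasing function `G (W x t)` has the `t`-derivative `κ (U_t - f(t, U)) = κ U_xx`, where
`κ = G'(W) / ∂_a H` (`SolutionFamily.hasDerivAt_pullback`). Therefore `∫ κ U_xx dt ≤ 0` over one
period. Because `∂_u f` is Lipschitz in `u`, so is `log ∂_a H` in `a`, and for
`G w = -exp (-M w) / M` with `M` large `κ` is a nonincreasing function of `W`, that is, nondecreasing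
in `x` (`SolutionFamily.exists_weight`). This is the concavity that replaces `U_xx = -f(U) ≤ 0` of
the autonomous case.

As `U_x < 0` and `κ` is nondecreasing in `x`, the function `B x = ∫ κ U_x dt` has upper right
derivative at most `∫ κ U_xx dt ≤ 0`. So `B` is bounded above by a negative constant, and so is
`∫ U_x dt`, `κ` being bounded. Then `∫ U dt` tends to `-∞`, contrary to `U ≥ 0`
(`false_of_weight`).

Working with the monotonicity of `κ` makes a second derivative of the flow unnecessary: the flow is
only of class `C^{1,1}` in the initial value, and all that is used about it is the estimate
`SolutionFamily.abs_sub_mul_exp_sub_le`.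
-/

namespace PeriodicRD

open MeasureTheory intervalIntegral

/-! ### The concavity argument -/

theorem hasDerivAt_integral_mul {c : ℝ → ℝ} {V V' : ℝ → ℝ → ℝ} {T : ℝ} (hc : Continuous c)
    (hV : ∀ x t, HasDerivAt (fun y => V y t) (V' x t) x) (hVt : ∀ x, Continuous (V x))
    (hV' : Continuous (Function.uncurry V')) (x : ℝ) :
    HasDerivAt (fun y => ∫ t in (0 : ℝ)..T, c t * V y t) (∫ t in (0 : ℝ)..T, c t * V' x t) x := by
  have hcont : Continuous (fun z : ℝ × ℝ => c z.2 * V' z.1 z.2) :=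
    (hc.comp continuous_snd).mul hV'
  obtain ⟨C, hC⟩ := ((isCompact_closedBall x 1).prod
    (isCompact_uIcc (a := 0) (b := T))).exists_bound_of_continuousOn hcont.continuousOn
  refine (hasDerivAt_integral_of_dominated_loc_of_deriv_le (bound := fun _ => C)
    (F := fun y t => c t * V y t) (F' := fun y t => c t * V' y t)
    (Metric.closedBall_mem_nhds x one_pos)
    (Eventually.of_forall fun y => (hc.mul (hVt y)).aestronglyMeasurable)
    ((hc.mul (hVt x)).intervalIntegrable _ _)
    (hcont.comp (Continuous.prodMk_right x)).aestronglyMeasurable ?_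
    intervalIntegrable_const ?_).2
  · exact Eventually.of_forall fun t ht y hy => hC (y, t) ⟨hy, uIoc_subset_uIcc ht⟩
  · exact Eventually.of_forall fun t _ y _ => (hV y t).const_mul _

/-- A weight `κ` of this kind cannot exist when `V` is bounded below: it makes `∫ κ V'` a
nonincreasing negative function of the space variable, so that `∫ V` tends to `-∞`. -/
theorem false_of_weight {V V' V'' κ : ℝ → ℝ → ℝ} {T x₁ C : ℝ} (hT : 0 < T)
    (hV0 : ∀ x t, 0 ≤ V x t)
    (hV : ∀ x t, HasDerivAt (fun y => V y t) (V' x t) x)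
    (hV₁ : ∀ x t, HasDerivAt (fun y => V' y t) (V'' x t) x)
    (hVc : Continuous (Function.uncurry V)) (hV'c : Continuous (Function.uncurry V'))
    (hV''c : Continuous (Function.uncurry V''))
    (hneg : ∀ x t, x₁ ≤ x → V' x t < 0)
    (hκc : Continuous (Function.uncurry κ)) (hκpos : ∀ x t, 0 < κ x t) (hκC : ∀ x t, κ x t ≤ C)
    (hκmono : ∀ x y t, x₁ ≤ x → x ≤ y → t ∈ Icc 0 T → κ x t ≤ κ y t)
    (hint : ∀ x, x₁ ≤ x → ∫ t in (0 : ℝ)..T, κ x t * V'' x t ≤ 0) : False := by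
  have sec : ∀ {F : ℝ → ℝ → ℝ}, Continuous (Function.uncurry F) → ∀ x, Continuous (F x) :=
    fun h x => h.comp (Continuous.prodMk_right x)
  have hC : 0 < C := (hκpos 0 0).trans_le (hκC 0 0)
  set B : ℝ → ℝ := fun x => ∫ t in (0 : ℝ)..T, κ x t * V' x t with hB
  have hBc : Continuous B :=
    continuous_parametric_intervalIntegral_of_continuous' (f := fun x t => κ x t * V' x t)
      (hκc.mul hV'c) 0 T
  have hii : ∀ x y, IntervalIntegrable (fun t => κ x t * V' y t) volume 0 T := fun x y =>
    ((sec hκc x).mul (sec hV'c y)).intervalIntegrable _ _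
  have hBanti : ∀ x, x₁ ≤ x → B x ≤ B x₁ := by
    intro b hb
    refine image_le_of_liminf_slope_right_le_deriv_boundary (f := B) (a := x₁) (b := b)
      (B := fun _ => B x₁) (B' := fun _ => 0) hBc.continuousOn le_rfl continuousOn_const
      (fun x _ => hasDerivWithinAt_const _ _ _) ?_ ⟨hb, le_rfl⟩
    intro x hx r hr
    -- freezing the weight at `x` gives a differentiable majorant of `B` to the right of `x`
    have hd := hasDerivAt_integral_mul (T := T) (sec hκc x) hV₁ (sec hV'c) hV''c x
    have hs := (hasDerivAt_iff_tendsto_slope.1 hd).mono_left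
      (nhdsWithin_mono x (fun z (hz : x < z) => hz.ne'))
    have hev := hs.eventually (gt_mem_nhds ((hint x hx.1).trans_lt hr))
    refine Eventually.frequently ?_
    filter_upwards [hev, self_mem_nhdsWithin] with z hz hxz
    refine lt_of_le_of_lt ?_ hz
    rw [slope_def_field, slope_def_field]
    have hxz' : x < z := hxz
    refine div_le_div_of_nonneg_right (sub_le_sub_right ?_ _) (sub_nonneg.2 hxz'.le)
    refine integral_mono_on hT.le (hii z z) (hii x z) fun t ht => ?_
    exact mul_le_mul_of_nonpos_right (hκmono x z t hx.1 hxz'.le ht)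
      (hneg z t (hx.1.trans hxz'.le)).le
  have hBneg : B x₁ < 0 := by
    have : 0 < ∫ t in (0 : ℝ)..T, -(κ x₁ t * V' x₁ t) :=
      intervalIntegral_pos_of_pos (hii x₁ x₁).neg
        (fun t => neg_pos.2 (mul_neg_of_pos_of_neg (hκpos _ _) (hneg _ _ le_rfl))) hT
    rw [intervalIntegral.integral_neg] at this
    simp only [hB]
    linarith
  have hVint : ∀ x, HasDerivAt (fun y => ∫ t in (0 : ℝ)..T, C * V y t)
      (∫ t in (0 : ℝ)..T, C * V' x t) x :=
    hasDerivAt_integral_mul continuous_const hV (sec hVc) hV'c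
  have hle : ∀ x, x₁ ≤ x → ∫ t in (0 : ℝ)..T, C * V' x t ≤ B x₁ := by
    intro x hx
    refine le_trans ?_ (hBanti x hx)
    refine integral_mono_on hT.le ((continuous_const.mul (sec hV'c x)).intervalIntegrable _ _)
      (hii x x) fun t _ => ?_
    exact mul_le_mul_of_nonpos_right (hκC x t) (hneg x t hx).le
  set S : ℝ → ℝ := fun y => ∫ t in (0 : ℝ)..T, C * V y t with hS
  have hS0 : ∀ y, 0 ≤ S y := fun y =>
    integral_nonneg hT.le fun t _ => mul_nonneg hC.le (hV0 y t)
  -- by the mean value inequality `S` would be negative here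
  have hx₂ : x₁ ≤ x₁ + (S x₁ + 1) / (-B x₁) := by
    have := div_nonneg (add_nonneg (hS0 x₁) zero_le_one) (neg_pos.2 hBneg).le
    linarith
  have hmv := (convex_Ici x₁).image_sub_le_mul_sub_of_deriv_le (f := S) (C := B x₁)
    (fun x _ => (hVint x).continuousAt.continuousWithinAt)
    (fun x _ => (hVint x).differentiableAt.differentiableWithinAt)
    (fun x hx => by
      rw [interior_Ici] at hx
      rw [(hVint x).deriv]; exact hle x (le_of_lt hx))
    x₁ self_mem_Ici _ hx₂ hx₂
  have h0 := hS0 (x₁ + (S x₁ + 1) / (-B x₁))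
  have : B x₁ * (x₁ + (S x₁ + 1) / (-B x₁) - x₁) = -(S x₁ + 1) := by
    field_simp [hBneg.ne]
    ring
  linarith

/-! ### Linear differential inequalities -/

/-- Two-sided exponential bound for a function satisfying `|d'| ≤ K |d|`. -/
theorem abs_le_exp_mul_abs {d d' : ℝ → ℝ} {K T : ℝ}
    (hd : ∀ t ∈ Icc 0 T, HasDerivWithinAt d (d' t) (Icc 0 T) t)
    (hK : ∀ t ∈ Icc 0 T, |d' t| ≤ K * |d t|) {t : ℝ} (ht : t ∈ Icc 0 T) :
    |d t| ≤ Real.exp (K * t) * |d 0| ∧ |d 0| ≤ Real.exp (K * t) * |d t| := by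
  have h0 : (0 : ℝ) ∈ Icc 0 T := ⟨le_rfl, ht.1.trans ht.2⟩
  have hdd : ∀ s ∈ Icc 0 T, |d s * d' s| ≤ K * d s ^ 2 := fun s hs => by
    rw [abs_mul, ← sq_abs]
    nlinarith [hK s hs, abs_nonneg (d s)]
  -- the monotone quantity is `± d² exp (± 2 K t)`
  have key : ∀ σ : ℝ, |σ| = 1 →
      MonotoneOn (fun s => σ * (d s ^ 2 * Real.exp (σ * (2 * K * s)))) (Icc 0 T) := by
    intro σ hσ
    have hder : ∀ s ∈ Icc 0 T,
        HasDerivWithinAt (fun s => σ * (d s ^ 2 * Real.exp (σ * (2 * K * s))))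
          (2 * Real.exp (σ * (2 * K * s)) * (σ * (d s * d' s) + σ ^ 2 * (K * d s ^ 2)))
          (Icc 0 T) s := by
      intro s hs
      have h1 : HasDerivWithinAt (fun s : ℝ => Real.exp (σ * (2 * K * s)))
          (Real.exp (σ * (2 * K * s)) * (σ * (2 * K * 1))) (Icc 0 T) s :=
        ((((hasDerivAt_id s).const_mul (2 * K)).const_mul σ).exp).hasDerivWithinAt
      refine ((((hd s hs).pow 2).mul h1).const_mul σ).congr_deriv ?_
      simp only [Pi.pow_apply]
      push_cast
      ring
    refine monotoneOn_of_hasDerivWithinAt_nonneg (convex_Icc 0 T)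
      (fun s hs => (hder s hs).continuousWithinAt)
      (fun s hs => (hder s (interior_subset hs)).mono interior_subset) fun s hs => ?_
    have h1 := hdd s (interior_subset hs)
    have h2 : |σ * (d s * d' s)| ≤ K * d s ^ 2 := by rwa [abs_mul, hσ, one_mul]
    have h3 : σ ^ 2 = 1 := by rw [← sq_abs, hσ, one_pow]
    rw [h3]
    have := neg_abs_le (σ * (d s * d' s))
    exact mul_nonneg (by positivity) (by linarith)
  have e2 : Real.exp (2 * K * t) = Real.exp (K * t) ^ 2 := by
    rw [← Real.exp_nat_mul]; congr 1; push_cast; ring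
  constructor
  · have h := key (-1) (by simp) h0 ht ht.1
    refine abs_le_of_sq_le_sq' ?_ (by positivity) |>.2
    simp only [mul_zero, Real.exp_zero, neg_one_mul, mul_one, Real.exp_neg, neg_le_neg_iff, e2] at h
    rw [sq_abs, mul_pow, sq_abs]
    rwa [← div_eq_mul_inv, div_le_iff₀' (by positivity)] at h
  · have h := key 1 (by simp) h0 ht ht.1
    refine abs_le_of_sq_le_sq' ?_ (by positivity) |>.2
    simp only [mul_zero, Real.exp_zero, one_mul, mul_one, e2] at h
    rw [sq_abs, mul_pow, sq_abs]
    linarith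

theorem pos_of_abs_deriv_le {d d' : ℝ → ℝ} {K T : ℝ}
    (hd : ∀ t ∈ Icc 0 T, HasDerivWithinAt d (d' t) (Icc 0 T) t)
    (hK : ∀ t ∈ Icc 0 T, |d' t| ≤ K * |d t|) (h0 : 0 < d 0) {t : ℝ} (ht : t ∈ Icc 0 T) :
    0 < d t := by
  by_contra! hneg
  have hsub : Icc 0 t ⊆ Icc 0 T := Icc_subset_Icc_right ht.2
  obtain ⟨s, hs, hs0⟩ := intermediate_value_Icc' ht.1
    (fun s hs => (hd s (hsub hs)).continuousWithinAt.mono hsub) ⟨hneg, h0.le⟩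
  have := (abs_le_exp_mul_abs hd hK (hsub hs)).2
  rw [hs0, abs_zero, mul_zero] at this
  exact (abs_pos.2 h0.ne').not_ge this

/-! ### The flow of the ordinary differential equation -/

/-- Solutions `H a` on `[0, T]` of `h' = f(t, h)`, `h(0) = a`, for `a ∈ [b₀, b₁]`, with values in
`[0, R]`, where `f` has a `u`-derivative `g` that is bounded by `K`, continuous, and
`L`-Lipschitz in `u`. That `g` is the derivative is recorded by the uniform second-order estimate
`taylor`, so that no one-sided derivatives occur at `u = 0`. -/
structure SolutionFamily (f g : ℝ → ℝ → ℝ) (T R K L b₀ b₁ : ℝ) (H : ℝ → ℝ → ℝ) : Prop where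
  T_pos : 0 < T
  K_nonneg : 0 ≤ K
  L_nonneg : 0 ≤ L
  continuousOn_g : ContinuousOn (fun z : ℝ × ℝ => g z.1 z.2) (Icc 0 T ×ˢ Icc 0 R)
  g_bound : ∀ t ∈ Icc 0 T, ∀ u ∈ Icc 0 R, |g t u| ≤ K
  g_lip : ∀ t ∈ Icc 0 T, ∀ u ∈ Icc 0 R, ∀ v ∈ Icc 0 R, |g t v - g t u| ≤ L * |v - u|
  f_lip : ∀ t ∈ Icc 0 T, ∀ u ∈ Icc 0 R, ∀ v ∈ Icc 0 R, |f t v - f t u| ≤ K * |v - u|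
  taylor : ∀ t ∈ Icc 0 T, ∀ u ∈ Icc 0 R, ∀ v ∈ Icc 0 R,
    |f t v - f t u - g t u * (v - u)| ≤ L * (v - u) ^ 2
  mem : ∀ a ∈ Icc b₀ b₁, ∀ t ∈ Icc 0 T, H a t ∈ Icc 0 R
  init : ∀ a ∈ Icc b₀ b₁, H a 0 = a
  deriv : ∀ a ∈ Icc b₀ b₁, ∀ t ∈ Icc 0 T, HasDerivWithinAt (H a) (f t (H a t)) (Icc 0 T) t

/-- The retraction of `ℝ` onto `[0, T]`. -/
def clamp (T t : ℝ) : ℝ := max 0 (min t T)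

theorem continuous_clamp (T : ℝ) : Continuous (clamp T) := by unfold clamp; fun_prop

theorem clamp_mem {T : ℝ} (hT : 0 < T) (t : ℝ) : clamp T t ∈ Icc 0 T :=
  ⟨le_max_left _ _, max_le hT.le (min_le_right _ _)⟩

theorem clamp_of_mem {T t : ℝ} (ht : t ∈ Icc 0 T) : clamp T t = t := by
  rw [clamp, min_eq_left ht.2, max_eq_right ht.1]

namespace SolutionFamily

variable {f g H : ℝ → ℝ → ℝ} {T R K L b₀ b₁ : ℝ}

/-- The exponent `∫₀ᵗ ∂ᵤf(s, H a s) ds` of the derivative of the flow in the initial value. The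
integrand is extended from `[0, T]` by constants. -/
noncomputable def expo (g H : ℝ → ℝ → ℝ) (T a t : ℝ) : ℝ :=
  ∫ s in (0 : ℝ)..t, g (clamp T s) (H a (clamp T s))

theorem zero_mem (h : SolutionFamily f g T R K L b₀ b₁ H) : (0 : ℝ) ∈ Icc 0 T :=
  ⟨le_rfl, h.T_pos.le⟩

theorem sub_bounds (h : SolutionFamily f g T R K L b₀ b₁ H) {a b t : ℝ} (ha : a ∈ Icc b₀ b₁)
    (hb : b ∈ Icc b₀ b₁) (ht : t ∈ Icc 0 T) :
    |H a t - H b t| ≤ Real.exp (K * T) * |a - b| ∧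
      |a - b| ≤ Real.exp (K * T) * |H a t - H b t| := by
  have key := abs_le_exp_mul_abs (d := fun s => H a s - H b s) (K := K)
    (fun s hs => (h.deriv a ha s hs).sub (h.deriv b hb s hs))
    (fun s hs => h.f_lip s hs _ (h.mem b hb s hs) _ (h.mem a ha s hs)) ht
  simp only [h.init a ha, h.init b hb] at key
  have hexp : Real.exp (K * t) ≤ Real.exp (K * T) :=
    Real.exp_le_exp.2 (mul_le_mul_of_nonneg_left ht.2 h.K_nonneg)
  exact ⟨key.1.trans (mul_le_mul_of_nonneg_right hexp (abs_nonneg _)),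
    key.2.trans (mul_le_mul_of_nonneg_right hexp (abs_nonneg _))⟩

theorem strictMonoOn (h : SolutionFamily f g T R K L b₀ b₁ H) {t : ℝ} (ht : t ∈ Icc 0 T) :
    StrictMonoOn (fun a => H a t) (Icc b₀ b₁) := by
  intro b hb a ha hab
  refine sub_pos.1 (pos_of_abs_deriv_le (d := fun s => H a s - H b s) (K := K)
    (fun s hs => (h.deriv a ha s hs).sub (h.deriv b hb s hs))
    (fun s hs => h.f_lip s hs _ (h.mem b hb s hs) _ (h.mem a ha s hs)) ?_ ht)
  simp only [h.init a ha, h.init b hb]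
  linarith

theorem continuousOn_initial (h : SolutionFamily f g T R K L b₀ b₁ H) {t : ℝ}
    (ht : t ∈ Icc 0 T) : ContinuousOn (fun a => H a t) (Icc b₀ b₁) := by
  refine (LipschitzOnWith.of_dist_le_mul (K := (Real.exp (K * T)).toNNReal)
    fun a ha b hb => ?_).continuousOn
  rw [Real.dist_eq, Real.dist_eq, Real.coe_toNNReal _ (Real.exp_pos _).le]
  exact (h.sub_bounds ha hb ht).1

theorem exists_eq (h : SolutionFamily f g T R K L b₀ b₁ H) (hb : b₀ ≤ b₁) {t y : ℝ}
    (ht : t ∈ Icc 0 T) (hy : y ∈ Icc (H b₀ t) (H b₁ t)) : ∃ a ∈ Icc b₀ b₁, H a t = y :=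
  intermediate_value_Icc hb (h.continuousOn_initial ht) hy

theorem continuous_clamp_sol (h : SolutionFamily f g T R K L b₀ b₁ H) {a : ℝ}
    (ha : a ∈ Icc b₀ b₁) : Continuous fun s => H a (clamp T s) :=
  ContinuousOn.comp_continuous (fun t ht => (h.deriv a ha t ht).continuousWithinAt)
    (continuous_clamp T) (clamp_mem h.T_pos)

theorem continuous_integrand (h : SolutionFamily f g T R K L b₀ b₁ H) {a : ℝ}
    (ha : a ∈ Icc b₀ b₁) : Continuous fun s => g (clamp T s) (H a (clamp T s)) :=
  h.continuousOn_g.comp_continuous ((continuous_clamp T).prodMk (h.continuous_clamp_sol ha))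
    fun s => ⟨clamp_mem h.T_pos s, h.mem a ha _ (clamp_mem h.T_pos s)⟩

theorem hasDerivAt_expo (h : SolutionFamily f g T R K L b₀ b₁ H) {a : ℝ} (ha : a ∈ Icc b₀ b₁)
    (t : ℝ) : HasDerivAt (expo g H T a) (g (clamp T t) (H a (clamp T t))) t :=
  (h.continuous_integrand ha).integral_hasStrictDerivAt 0 t |>.hasDerivAt

theorem abs_expo_le (h : SolutionFamily f g T R K L b₀ b₁ H) {a t : ℝ} (ha : a ∈ Icc b₀ b₁)
    (ht : t ∈ Icc 0 T) : |expo g H T a t| ≤ K * T := by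
  have := norm_integral_le_of_norm_le_const (a := 0) (b := t) (C := K)
    (f := fun s => g (clamp T s) (H a (clamp T s))) fun s _ =>
      h.g_bound _ (clamp_mem h.T_pos s) _ (h.mem a ha _ (clamp_mem h.T_pos s))
  rw [sub_zero, abs_of_nonneg ht.1] at this
  exact this.trans (mul_le_mul_of_nonneg_left ht.2 h.K_nonneg)

theorem abs_expo_sub_le (h : SolutionFamily f g T R K L b₀ b₁ H) {a b t : ℝ}
    (ha : a ∈ Icc b₀ b₁) (hb : b ∈ Icc b₀ b₁) (ht : t ∈ Icc 0 T) :
    |expo g H T a t - expo g H T b t| ≤ L * Real.exp (K * T) * T * |a - b| := by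
  rw [expo, expo, ← integral_sub ((h.continuous_integrand ha).intervalIntegrable _ _)
    ((h.continuous_integrand hb).intervalIntegrable _ _)]
  have := norm_integral_le_of_norm_le_const (a := 0) (b := t)
    (C := L * Real.exp (K * T) * |a - b|)
    (f := fun s => g (clamp T s) (H a (clamp T s)) - g (clamp T s) (H b (clamp T s))) fun s _ => by
      have hs := clamp_mem h.T_pos s
      refine (h.g_lip _ hs _ (h.mem b hb _ hs) _ (h.mem a ha _ hs)).trans ?_
      rw [mul_assoc]
      exact mul_le_mul_of_nonneg_left (h.sub_bounds ha hb hs).1 h.L_nonneg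
  rw [sub_zero, abs_of_nonneg ht.1] at this
  refine this.trans ?_
  have hL := h.L_nonneg
  calc L * Real.exp (K * T) * |a - b| * t ≤ L * Real.exp (K * T) * |a - b| * T :=
        mul_le_mul_of_nonneg_left ht.2 (by positivity)
    _ = _ := by ring

/-- Second-order accuracy of the linearized flow, in terms of the integrating factor
`exp (-expo b)`. -/
theorem abs_sub_mul_exp_sub_le (h : SolutionFamily f g T R K L b₀ b₁ H) {a b t : ℝ}
    (ha : a ∈ Icc b₀ b₁) (hb : b ∈ Icc b₀ b₁) (ht : t ∈ Icc 0 T) :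
    |(H a t - H b t) * Real.exp (-expo g H T b t) - (a - b)| ≤
      L * Real.exp (K * T) ^ 3 * T * (a - b) ^ 2 := by
  have hder : ∀ s ∈ Icc 0 T, HasDerivWithinAt
      (fun s => (H a s - H b s) * Real.exp (-expo g H T b s))
      ((f s (H a s) - f s (H b s) - g s (H b s) * (H a s - H b s)) * Real.exp (-expo g H T b s))
      (Icc 0 T) s := by
    intro s hs
    have h1 := (h.hasDerivAt_expo hb s).neg.exp.hasDerivWithinAt (s := Icc 0 T)
    rw [clamp_of_mem hs] at h1
    refine (((h.deriv a ha s hs).sub (h.deriv b hb s hs)).mul h1).congr_deriv ?_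
    simp only [Pi.sub_apply, Pi.neg_apply]
    ring
  have hbd : ∀ s ∈ Icc 0 T, ‖(f s (H a s) - f s (H b s) - g s (H b s) * (H a s - H b s)) *
      Real.exp (-expo g H T b s)‖ ≤ L * Real.exp (K * T) ^ 3 * (a - b) ^ 2 := by
    intro s hs
    rw [Real.norm_eq_abs, abs_mul, Real.abs_exp]
    have h1 := h.taylor s hs _ (h.mem b hb s hs) _ (h.mem a ha s hs)
    have h2 : (H a s - H b s) ^ 2 ≤ (Real.exp (K * T) * |a - b|) ^ 2 := by
      rw [← sq_abs]
      exact pow_le_pow_left₀ (abs_nonneg _) (h.sub_bounds ha hb hs).1 2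
    have h3 : Real.exp (-expo g H T b s) ≤ Real.exp (K * T) :=
      Real.exp_le_exp.2 ((neg_le_abs _).trans (h.abs_expo_le hb hs))
    calc _ ≤ (L * (Real.exp (K * T) * |a - b|) ^ 2) * Real.exp (K * T) :=
          mul_le_mul (h1.trans (mul_le_mul_of_nonneg_left h2 h.L_nonneg)) h3 (Real.exp_pos _).le
            (mul_nonneg h.L_nonneg (sq_nonneg _))
      _ = _ := by rw [mul_pow, sq_abs]; ring
  have := (convex_Icc 0 T).norm_image_sub_le_of_norm_hasDerivWithin_le hder hbd h.zero_mem ht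
  simp only [h.init a ha, h.init b hb, expo, integral_same, neg_zero, Real.exp_zero, mul_one,
    sub_zero, Real.norm_eq_abs, abs_of_nonneg ht.1] at this
  refine this.trans ?_
  have hL := h.L_nonneg
  calc _ ≤ L * Real.exp (K * T) ^ 3 * (a - b) ^ 2 * T :=
        mul_le_mul_of_nonneg_left ht.2 (by positivity)
    _ = _ := by ring

/-- Writing a curve as `u(s) = H (w s) s`, its pull-back `w` along the flow is differentiable, and
`w'` is the defect `u' - f(t, u)` divided by the derivative `exp (expo w)` of the flow. -/
theorem hasDerivAt_pullback (h : SolutionFamily f g T R K L b₀ b₁ H) {w u : ℝ → ℝ} {u' t : ℝ}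
    (hw : ∀ s ∈ Icc 0 T, w s ∈ Icc b₀ b₁) (hwu : ∀ s ∈ Icc 0 T, H (w s) s = u s)
    (ht : t ∈ Ioo 0 T) (hu : HasDerivAt u u' t) :
    HasDerivAt w ((u' - f t (u t)) * Real.exp (-expo g H T (w t) t)) t := by
  have ht' : t ∈ Icc 0 T := Ioo_subset_Icc_self ht
  have hb := hw t ht'
  have hnhds : Icc 0 T ∈ 𝓝 t := Icc_mem_nhds ht.1 ht.2
  have hr : HasDerivAt (fun s => u s - H (w t) s) (u' - f t (u t)) t := by
    have := (h.deriv _ hb t ht').hasDerivAt hnhds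
    rw [hwu t ht'] at this
    exact hu.sub this
  have hr0 : u t - H (w t) t = 0 := by rw [hwu t ht', sub_self]
  have he : HasDerivAt (fun s => (u s - H (w t) s) * Real.exp (-expo g H T (w t) s))
      ((u' - f t (u t)) * Real.exp (-expo g H T (w t) t)) t := by
    have := hr.mul (h.hasDerivAt_expo hb t).neg.exp
    rw [hr0, zero_mul, add_zero] at this
    exact this
  set C := L * Real.exp (K * T) ^ 3 * T * Real.exp (K * T) ^ 2 with hC
  -- the error made in replacing `w` by its linearization is quadratic in `u - H (w t)`
  have hm : HasDerivAt (fun s => (u s - H (w t) s) * Real.exp (-expo g H T (w t) s) -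
      (w s - w t)) 0 t := by
    have hsq : HasDerivAt (fun s => C * (u s - H (w t) s) ^ 2) 0 t := by
      have := (hr.pow 2).const_mul C
      simpa [hr0] using this
    rw [hasDerivAt_iff_isLittleO] at hsq ⊢
    refine Asymptotics.IsBigO.trans_isLittleO (Asymptotics.IsBigO.of_bound 1 ?_) hsq
    filter_upwards [hnhds] with s hs
    have h1 := h.abs_sub_mul_exp_sub_le (hw s hs) hb hs
    have h2 := (h.sub_bounds (hw s hs) hb hs).2
    rw [hwu s hs] at h1 h2
    simp only [hr0, zero_mul, sub_self, sub_zero, smul_zero, Real.norm_eq_abs, one_mul, ne_eq,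
      OfNat.ofNat_ne_zero, not_false_eq_true, zero_pow, mul_zero]
    refine (h1.trans ?_).trans (le_abs_self _)
    have h3 : (w s - w t) ^ 2 ≤ (Real.exp (K * T) * |u s - H (w t) s|) ^ 2 := by
      rw [← sq_abs]; exact pow_le_pow_left₀ (abs_nonneg _) h2 2
    have hL := h.L_nonneg
    have hT := h.T_pos
    calc _ ≤ L * Real.exp (K * T) ^ 3 * T * (Real.exp (K * T) * |u s - H (w t) s|) ^ 2 :=
          mul_le_mul_of_nonneg_left h3 (by positivity)
      _ = _ := by rw [mul_pow, sq_abs, hC]; ring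
  have := (he.sub hm).add_const (w t)
  simpa using this

end SolutionFamily

/-! ### Regularity of the nonlinearity -/

theorem IsAdmissible.hasDerivWithinAt {f : ℝ → ℝ → ℝ} {T : ℝ} (hf : IsAdmissible f T) (t : ℝ)
    {u : ℝ} (hu : 0 ≤ u) :
    HasDerivWithinAt (f t) (derivWithin (f t) (Ici 0) u) (Ici 0) u :=
  ((hf.contDiff t).differentiableOn one_ne_zero u hu).hasDerivWithinAt

theorem IsAdmissible.taylor {f : ℝ → ℝ → ℝ} {T R : ℝ} (hf : IsAdmissible f T) {L : ℝ≥0} {t : ℝ}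
    (hL : LipschitzOnWith L (fun u => derivWithin (f t) (Ici 0) u) (Icc 0 R)) {u v : ℝ}
    (hu : u ∈ Icc 0 R) (hv : v ∈ Icc 0 R) :
    |f t v - f t u - derivWithin (f t) (Ici 0) u * (v - u)| ≤ L * (v - u) ^ 2 := by
  have hsub : uIcc u v ⊆ Icc 0 R := uIcc_subset_Icc hu hv
  have hder : ∀ s ∈ uIcc u v,
      HasDerivWithinAt (fun s => f t s - derivWithin (f t) (Ici 0) u * s)
        (derivWithin (f t) (Ici 0) s - derivWithin (f t) (Ici 0) u) (uIcc u v) s := by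
    intro s hs
    have h1 := (hf.hasDerivWithinAt t (hsub hs).1).mono (t := Ici 0) (s := uIcc u v)
      fun x hx => (hsub hx).1
    refine (h1.sub ((hasDerivWithinAt_id s (uIcc u v)).const_mul
      (derivWithin (f t) (Ici 0) u))).congr_deriv ?_
    rw [mul_one]
  have := (convex_uIcc u v).norm_image_sub_le_of_norm_hasDerivWithin_le
    (C := L * |v - u|) hder (fun s hs => by
      have h1 := hL.dist_le_mul s (hsub hs) u hu
      rw [Real.dist_eq, Real.dist_eq] at h1
      exact h1.trans (mul_le_mul_of_nonneg_left (abs_sub_left_of_mem_uIcc hs) L.2))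
    left_mem_uIcc right_mem_uIcc
  rw [Real.norm_eq_abs, Real.norm_eq_abs, mul_assoc, ← sq, sq_abs] at this
  convert this using 2
  ring

/-- The `u`-derivative of `f` is jointly continuous: it is a locally uniform limit of difference
quotients in `u`. -/
theorem IsAdmissible.continuousOn_derivWithin {f : ℝ → ℝ → ℝ} {T : ℝ} (hf : IsAdmissible f T)
    (R : ℝ) : ContinuousOn (fun z : ℝ × ℝ => derivWithin (f z.1) (Ici 0) z.2)
      (Icc 0 T ×ˢ Icc 0 R) := by
  obtain ⟨L, hL⟩ := hf.lipschitz (R + 1)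
  obtain ⟨C, α, hα, -, hH⟩ := hf.holder (max T (R + 1))
  have hfc := hH.continuousOn hα
  have hlim : Tendsto (fun n : ℕ => (1 / (n + 1) : ℝ)) atTop (𝓝 0) :=
    tendsto_one_div_add_atTop_nhds_zero_nat
  have hs : ∀ n : ℕ, (0 : ℝ) < 1 / (n + 1) ∧ (1 / (n + 1) : ℝ) ≤ 1 := fun n =>
    ⟨Nat.one_div_pos_of_nat, by
      rw [div_le_one (by positivity)]; linarith [(Nat.cast_nonneg n : (0 : ℝ) ≤ n)]⟩
  have hunif : TendstoUniformlyOn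
      (fun (n : ℕ) (z : ℝ × ℝ) => (f z.1 (z.2 + 1 / (n + 1)) - f z.1 z.2) / (1 / (n + 1) : ℝ))
      (fun z : ℝ × ℝ => derivWithin (f z.1) (Ici 0) z.2) atTop (Icc 0 T ×ˢ Icc 0 R) := by
    rw [Metric.tendstoUniformlyOn_iff]
    intro ε hε
    have h0 : Tendsto (fun n : ℕ => L * (1 / (n + 1) : ℝ)) atTop (𝓝 0) := by
      simpa using hlim.const_mul (L : ℝ)
    filter_upwards [h0.eventually (gt_mem_nhds hε)] with n hn z hz
    obtain ⟨hp, h1⟩ := hs n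
    refine lt_of_le_of_lt ?_ hn
    generalize (1 / (n + 1) : ℝ) = δ at hp h1
    have ht := hf.taylor (hL z.1) (u := z.2) (v := z.2 + δ)
      ⟨hz.2.1, by linarith [hz.2.2]⟩ ⟨by linarith [hz.2.1], by linarith [hz.2.2]⟩
    rw [add_sub_cancel_left] at ht
    rw [dist_comm, Real.dist_eq, div_sub' hp.ne', abs_div, abs_of_pos hp, div_le_iff₀ hp, mul_comm δ]
    linarith
  refine hunif.continuousOn (Eventually.frequently (Eventually.of_forall fun n => ?_))
  obtain ⟨hp, h1⟩ := hs n
  have hmem : ∀ z : ℝ × ℝ, z ∈ Icc 0 T ×ˢ Icc 0 R → ∀ δ : ℝ, 0 ≤ δ → δ ≤ 1 →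
      (z.1, z.2 + δ) ∈ Icc (-(max T (R + 1))) (max T (R + 1)) ×ˢ Icc 0 (max T (R + 1)) := by
    intro z hz δ h0 h1
    obtain ⟨⟨a, b⟩, c, d⟩ := hz
    have h2 := le_max_left T (R + 1)
    have h3 := le_max_right T (R + 1)
    exact ⟨⟨by simp only; linarith, by simp only; linarith⟩, by simp only; linarith,
      by simp only; linarith⟩
  refine ContinuousOn.div_const (ContinuousOn.sub ?_ ?_) _
  · exact hfc.comp (f := fun z : ℝ × ℝ => (z.1, z.2 + (1 / (n + 1) : ℝ))) (by fun_prop)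
      fun z hz => hmem z hz _ hp.le h1
  · refine hfc.mono fun z hz => ?_
    simpa using hmem z hz 0 le_rfl zero_le_one

/-- Solutions depending on the initial value in `[b₀, b₁]` form a `SolutionFamily`; the common
bound on them comes from the solution starting at `b₁`, the largest one. -/
theorem IsAdmissible.exists_solutionFamily {f : ℝ → ℝ → ℝ} {T : ℝ} (hf : IsAdmissible f T)
    (hT : 0 < T) {b₀ b₁ : ℝ} (hb : b₀ ≤ b₁) {H : ℝ → ℝ → ℝ}
    (hnonneg : ∀ a ∈ Icc b₀ b₁, ∀ t ∈ Icc 0 T, 0 ≤ H a t)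
    (hinit : ∀ a ∈ Icc b₀ b₁, H a 0 = a)
    (hderiv : ∀ a ∈ Icc b₀ b₁, ∀ t ∈ Icc 0 T,
      HasDerivWithinAt (H a) (f t (H a t)) (Icc 0 T) t) :
    ∃ R K L : ℝ, SolutionFamily f (fun t u => derivWithin (f t) (Ici 0) u) T R K L b₀ b₁ H := by
  have hKex : ∀ R, ∃ K : ℝ, 0 ≤ K ∧
      ∀ t ∈ Icc 0 T, ∀ u ∈ Icc 0 R, |derivWithin (f t) (Ici 0) u| ≤ K := by
    intro R
    obtain ⟨K, hK⟩ := (isCompact_Icc.prod isCompact_Icc).exists_bound_of_continuousOn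
      (hf.continuousOn_derivWithin R)
    exact ⟨max K 0, le_max_right _ _, fun t ht u hu =>
      (hK (t, u) ⟨ht, hu⟩).trans (le_max_left _ _)⟩
  have hflip : ∀ {R K : ℝ}, (∀ t ∈ Icc 0 T, ∀ u ∈ Icc 0 R, |derivWithin (f t) (Ici 0) u| ≤ K) →
      ∀ t ∈ Icc 0 T, ∀ u ∈ Icc 0 R, ∀ v ∈ Icc 0 R, |f t v - f t u| ≤ K * |v - u| := by
    intro R K hK t ht u hu v hv
    exact (convex_Icc 0 R).norm_image_sub_le_of_norm_hasDerivWithin_le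
      (fun s hs => (hf.hasDerivWithinAt t hs.1).mono fun x hx => hx.1) (hK t ht) hu hv
  have hbd : ∀ a ∈ Icc b₀ b₁, ∃ R, ∀ t ∈ Icc 0 T, H a t ≤ R := by
    intro a ha
    obtain ⟨R, hR⟩ := isCompact_Icc.exists_bound_of_continuousOn (s := Icc 0 T)
      fun t ht => (hderiv a ha t ht).continuousWithinAt
    exact ⟨R, fun t ht => (le_abs_self _).trans (hR t ht)⟩
  have hb₁ : b₁ ∈ Icc b₀ b₁ := ⟨hb, le_rfl⟩
  obtain ⟨R, hR⟩ := hbd b₁ hb₁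
  have hmem : ∀ a ∈ Icc b₀ b₁, ∀ t ∈ Icc 0 T, H a t ∈ Icc 0 R := by
    intro a ha t ht
    refine ⟨hnonneg a ha t ht, le_trans ?_ (hR t ht)⟩
    rcases ha.2.eq_or_lt with rfl | hlt
    · exact le_rfl
    obtain ⟨R', hR'⟩ := hbd a ha
    obtain ⟨K', -, hK'⟩ := hKex (max R R')
    refine (sub_pos.1 (pos_of_abs_deriv_le (d := fun s => H b₁ s - H a s) (K := K')
      (fun s hs => (hderiv b₁ hb₁ s hs).sub (hderiv a ha s hs))
      (fun s hs => hflip hK' s hs _ ⟨hnonneg a ha s hs, (hR' s hs).trans (le_max_right _ _)⟩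
        _ ⟨hnonneg b₁ hb₁ s hs, (hR s hs).trans (le_max_left _ _)⟩) ?_ ht)).le
    simp only [hinit a ha, hinit b₁ hb₁]
    linarith
  obtain ⟨K, hK0, hK⟩ := hKex R
  obtain ⟨L, hL⟩ := hf.lipschitz R
  exact ⟨R, K, L, {
    T_pos := hT
    K_nonneg := hK0
    L_nonneg := L.2
    continuousOn_g := hf.continuousOn_derivWithin R
    g_bound := hK
    g_lip := fun t _ u hu v hv => by
      have := (hL t).dist_le_mul v hv u hu
      rwa [Real.dist_eq, Real.dist_eq] at this
    f_lip := hflip hK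
    taylor := fun t _ u hu v hv => hf.taylor (hL t) hu hv
    mem := hmem
    init := hinit
    deriv := hderiv }⟩

/-! ### The weight and the profile -/

/-- The weight: `κ = exp (-M W - expo W)`, where `W` is the pull-back of `U` to time `0` along the
flow. It is the `u`-derivative of the first integral `-exp (-M W) / M`, and `M` is so large that
this first integral is concave in `u`. Outside `[x₁, ∞) × [0, T]` the pull-back is extended through
the retractions `max · x₁` and `clamp T`, which makes it continuous on the whole plane. -/
theorem SolutionFamily.exists_weight {f g H U Ut D : ℝ → ℝ → ℝ} {T R K L b₀ b₁ x₁ : ℝ}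
    (h : SolutionFamily f g T R K L b₀ b₁ H) (hb : b₀ ≤ b₁)
    (hret : ∀ a ∈ Icc b₀ b₁, a ≤ H a T)
    (hUc : Continuous (Function.uncurry U))
    (hrange : ∀ x, x₁ ≤ x → ∀ t ∈ Icc 0 T, U x t ∈ Icc (H b₀ t) (H b₁ t))
    (hanti : ∀ x y t, x₁ ≤ x → x ≤ y → U y t ≤ U x t)
    (hper : ∀ x, U x T = U x 0)
    (hUt : ∀ x t, HasDerivAt (U x) (Ut x t) t)
    (hD : ∀ x t, D x t = Ut x t - f t (U x t)) (hDc : Continuous (Function.uncurry D)) :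
    ∃ (κ : ℝ → ℝ → ℝ) (C : ℝ), Continuous (Function.uncurry κ) ∧ (∀ x t, 0 < κ x t) ∧
      (∀ x t, κ x t ≤ C) ∧
      (∀ x y t, x₁ ≤ x → x ≤ y → t ∈ Icc 0 T → κ x t ≤ κ y t) ∧
      ∀ x, x₁ ≤ x → ∫ t in (0 : ℝ)..T, κ x t * D x t ≤ 0 := by
  have hcl := clamp_mem h.T_pos
  have hex : ∀ x t, ∃ a ∈ Icc b₀ b₁, H a (clamp T t) = U (max x x₁) (clamp T t) := fun x t =>
    h.exists_eq hb (hcl t) (hrange _ (le_max_right _ _) _ (hcl t))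
  choose W hWmem hWeq using hex
  have hWc : Continuous (Function.uncurry W) := by
    rw [continuous_iff_continuousAt]
    rintro ⟨x, t⟩
    have hc : Continuous fun z : ℝ × ℝ => Real.exp (K * T) *
        |U (max z.1 x₁) (clamp T z.2) - H (W x t) (clamp T z.2)| := by
      have h1 := (h.continuous_clamp_sol (hWmem x t)).comp (continuous_snd (X := ℝ) (Y := ℝ))
      have h2 : Continuous fun z : ℝ × ℝ => U (max z.1 x₁) (clamp T z.2) :=
        hUc.comp ((continuous_fst.max continuous_const).prodMk
          ((continuous_clamp T).comp continuous_snd))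
      exact continuous_const.mul (h2.sub h1).abs
    have h0 := hc.tendsto (x, t)
    simp only [hWeq x t, sub_self, abs_zero, mul_zero] at h0
    refine tendsto_iff_dist_tendsto_zero.2 (squeeze_zero (fun _ => dist_nonneg) (fun z => ?_) h0)
    have := (h.sub_bounds (hWmem z.1 z.2) (hWmem x t) (hcl z.2)).2
    rwa [hWeq z.1 z.2] at this
  have hEc : Continuous fun z : ℝ × ℝ => expo g H T (W z.1 z.2) (clamp T z.2) := by
    rw [continuous_iff_continuousAt]
    rintro ⟨x, t⟩
    have h1 : Tendsto (fun z : ℝ × ℝ => expo g H T (W z.1 z.2) (clamp T z.2) -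
        expo g H T (W x t) (clamp T z.2)) (𝓝 (x, t)) (𝓝 0) := by
      have h0 : Tendsto (fun z : ℝ × ℝ => L * Real.exp (K * T) * T * |W z.1 z.2 - W x t|)
          (𝓝 (x, t)) (𝓝 0) := by
        have hc : Continuous fun z : ℝ × ℝ =>
            L * Real.exp (K * T) * T * |W z.1 z.2 - W x t| :=
          continuous_const.mul (hWc.sub continuous_const).abs
        simpa using hc.tendsto (x, t)
      exact squeeze_zero_norm
        (fun z => h.abs_expo_sub_le (hWmem z.1 z.2) (hWmem x t) (hcl z.2)) h0
    have h2 : Continuous fun z : ℝ × ℝ => expo g H T (W x t) (clamp T z.2) :=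
      (continuous_iff_continuousAt.2 fun s =>
        (h.hasDerivAt_expo (hWmem x t) s).continuousAt).comp
          ((continuous_clamp T).comp continuous_snd)
    simpa [ContinuousAt] using h1.add (h2.tendsto (x, t))
  set M : ℝ := L * Real.exp (K * T) * T + 1 with hM
  have hM0 : 0 < M := by
    have hL := h.L_nonneg
    have hT := h.T_pos
    positivity
  have hκc : Continuous fun z : ℝ × ℝ =>
      Real.exp (-M * W z.1 z.2 - expo g H T (W z.1 z.2) (clamp T z.2)) :=
    ((continuous_const.mul hWc).sub hEc).rexp
  refine ⟨fun x t => Real.exp (-M * W x t - expo g H T (W x t) (clamp T t)),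
    Real.exp (-M * b₀ + K * T), hκc, fun _ _ => Real.exp_pos _, fun x t => ?_,
    fun x y t hx hxy ht => ?_, fun x hx => ?_⟩
  · have h1 := (neg_le_abs _).trans (h.abs_expo_le (hWmem x t) (hcl t))
    have h2 := mul_le_mul_of_nonneg_left (hWmem x t).1 hM0.le
    exact Real.exp_le_exp.2 (by linarith)
  · have hle : W y t ≤ W x t := by
      refine ((h.strictMonoOn (hcl t)).le_iff_le (hWmem y t) (hWmem x t)).1 ?_
      simp only [hWeq, max_eq_left hx, max_eq_left (hx.trans hxy)]
      exact hanti x y _ hx hxy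
    have h1 := (neg_le_abs _).trans (h.abs_expo_sub_le (hWmem x t) (hWmem y t) (hcl t))
    rw [abs_of_nonneg (sub_nonneg.2 hle)] at h1
    exact Real.exp_le_exp.2 (by rw [hM]; linarith)
  · have hweq : ∀ t ∈ Icc 0 T, H (W x t) t = U x t := fun t ht => by
      have := hWeq x t
      rwa [clamp_of_mem ht, max_eq_left hx] at this
    have hder : ∀ t ∈ Ioo 0 T, HasDerivAt (fun t => -(Real.exp (-M * W x t) / M))
        (Real.exp (-M * W x t - expo g H T (W x t) (clamp T t)) * D x t) t := by
      intro t ht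
      have h1 := h.hasDerivAt_pullback (fun s _ => hWmem x s) hweq ht (hUt x t)
      refine (((h1.const_mul (-M)).exp.div_const M).neg).congr_deriv ?_
      rw [clamp_of_mem (Ioo_subset_Icc_self ht), sub_eq_add_neg (-M * W x t), Real.exp_add, hD]
      field_simp
    have hWx : Continuous (W x) := hWc.comp (Continuous.prodMk_right x)
    have hGc : Continuous fun t => -(Real.exp (-M * W x t) / M) :=
      ((continuous_const.mul hWx).rexp.div_const M).neg
    rw [integral_eq_sub_of_hasDerivAt_of_le h.T_pos.le hGc.continuousOn hder
      (((hκc.comp (Continuous.prodMk_right x)).mul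
        (hDc.comp (Continuous.prodMk_right x))).intervalIntegrable _ _)]
    have hT0 : W x T ≤ W x 0 := by
      have h1 := hweq 0 h.zero_mem
      have h2 := hweq T ⟨h.T_pos.le, le_rfl⟩
      rw [h.init _ (hWmem x 0)] at h1
      rw [h1, ← hper x, ← h2]
      exact hret _ (hWmem x T)
    have := div_le_div_of_nonneg_right (Real.exp_le_exp.2
      (by nlinarith : -M * W x 0 ≤ -M * W x T)) hM0.le
    linarith

/-- Initial values just above `p 0` have solutions on `[0, T]` that do not decrease over one
period. -/
theorem exists_solution_of_mem_YPer {f : ℝ → ℝ → ℝ} {T : ℝ} {p : ℝ → ℝ}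
    (hp : p ∈ YPer f T) : ∃ b₁, p 0 < b₁ ∧ ∃ H : ℝ → ℝ → ℝ, H (p 0) = p ∧
      ∀ a ∈ Icc (p 0) b₁, (∀ t ∈ Icc 0 T, 0 ≤ H a t) ∧ H a 0 = a ∧
        (∀ t ∈ Icc 0 T, HasDerivWithinAt (H a) (f t (H a t)) (Icc 0 T) t) ∧ a ≤ H a T := by
  obtain ⟨⟨hp0, hpT, hpd⟩, ε, hε, hmono⟩ := hp
  have key : ∀ a ∈ Ioc (p 0) (p 0 + ε / 2), ∃ h : ℝ → ℝ, (∀ t ∈ Icc 0 T, 0 ≤ h t) ∧ h 0 = a ∧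
      (∀ t ∈ Icc 0 T, HasDerivWithinAt h (f t (h t)) (Icc 0 T) t) ∧ a ≤ h T := by
    intro a ha
    have use_init : ∀ {h : ℝ → ℝ} {τ : EReal}, IsInitialSolution f a h τ → (T : EReal) < τ →
        h 0 ≤ h T → ∃ h : ℝ → ℝ, (∀ t ∈ Icc 0 T, 0 ≤ h t) ∧ h 0 = a ∧
          (∀ t ∈ Icc 0 T, HasDerivWithinAt h (f t (h t)) (Icc 0 T) t) ∧ a ≤ h T := by
      intro h τ hh hτ hle
      have hlt : ∀ t ∈ Icc 0 T, (t : EReal) < τ := fun t ht =>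
        (EReal.coe_le_coe_iff.2 ht.2).trans_lt hτ
      exact ⟨h, fun t ht => (hh.2.2 t ht.1 (hlt t ht)).1, hh.2.1,
        fun t ht => (hh.2.2 t ht.1 (hlt t ht)).2.mono Icc_subset_Ici_self, hh.2.1 ▸ hle⟩
    rcases hmono a ⟨ha.1, by linarith [ha.2]⟩ with ⟨h, hmax, hper⟩ | ⟨h, τ, hmax, hτ, hinc⟩
    · refine use_init hmax.1 (EReal.coe_lt_top T) ?_
      have := hper 0 le_rfl
      rw [zero_add] at this
      exact this.ge
    · refine use_init hmax.1 hτ ?_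
      have := hinc 0 le_rfl (by rwa [zero_add])
      rw [zero_add] at this
      exact this.le
  choose! H₀ hH₀ using key
  refine ⟨p 0 + ε / 2, by linarith, fun a => if a = p 0 then p else H₀ a, if_pos rfl, ?_⟩
  intro a ha
  rcases ha.1.eq_or_lt with rfl | hlt
  · simp only [if_true]
    exact ⟨fun t _ => hp0 t, trivial, fun t _ => (hpd t).hasDerivWithinAt, by
      rw [← zero_add T, hpT]⟩
  · simp only [if_neg hlt.ne']
    exact hH₀ a ⟨hlt, ha.2⟩

/-- By Dini's theorem a profile that decreases in space does so to its base uniformly in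
`t ∈ [0, T]`, hence it eventually stays between the base and any `q` lying above it. -/
theorem exists_forall_lt_of_base {U : ℝ → ℝ → ℝ} {p q : ℝ → ℝ} {x₀ T : ℝ}
    (hUc : ∀ x, Continuous (U x)) (hanti : ∀ t, AntitoneOn (fun x => U x t) (Ici x₀))
    (hlim : ∀ t, Tendsto (fun x => U x t) atTop (𝓝 (p t)))
    (hp : ContinuousOn p (Icc 0 T)) (hq : ContinuousOn q (Icc 0 T))
    (hpq : ∀ t ∈ Icc 0 T, p t < q t) :
    ∃ x₁, x₀ < x₁ ∧ ∀ x, x₁ ≤ x → ∀ t ∈ Icc 0 T, p t ≤ U x t ∧ U x t ≤ q t := by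
  have hlow : ∀ x, x₀ ≤ x → ∀ t, p t ≤ U x t := fun x hx t =>
    le_of_tendsto (hlim t) (by
      filter_upwards [eventually_ge_atTop x] with y hy
      exact hanti t hx (hx.trans hy) hy)
  have hunif := Antitone.tendstoUniformlyOn_of_forall_tendsto (s := Icc 0 T)
    (F := fun (n : ℕ) t => U (x₀ + n) t) (f := p) isCompact_Icc
    (fun n => (hUc _).continuousOn)
    (fun t _ m n hmn => hanti t (mem_Ici.2 (le_add_of_nonneg_right (Nat.cast_nonneg _)))
      (mem_Ici.2 (le_add_of_nonneg_right (Nat.cast_nonneg _)))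
      (add_le_add_right (Nat.cast_le.2 hmn) x₀))
    hp (fun t _ => (hlim t).comp
      (tendsto_atTop_add_const_left _ x₀ tendsto_natCast_atTop_atTop))
  rcases (Icc (0 : ℝ) T).eq_empty_or_nonempty with he | hne
  · exact ⟨x₀ + 1, by linarith, fun x _ t ht => by simp [he] at ht⟩
  obtain ⟨t₀, ht₀, hmin⟩ := isCompact_Icc.exists_isMinOn hne (hq.sub hp)
  have hδ : 0 < q t₀ - p t₀ := sub_pos.2 (hpq t₀ ht₀)
  obtain ⟨n, hn⟩ := (Metric.tendstoUniformlyOn_iff.1 hunif _ hδ).exists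
  refine ⟨x₀ + n + 1, by linarith [(Nat.cast_nonneg n : (0 : ℝ) ≤ n)], fun x hx t ht => ?_⟩
  have hn0 : x₀ ≤ x₀ + n := le_add_of_nonneg_right (Nat.cast_nonneg n)
  have hx' : x₀ + n ≤ x := by linarith
  refine ⟨hlow x (hn0.trans hx') t, ?_⟩
  have h1 := (neg_le_abs _).trans_lt (hn t ht)
  have h2 : q t₀ - p t₀ ≤ q t - p t := hmin ht
  have h3 : U x t ≤ U (x₀ + n) t := hanti t hn0 (hn0.trans hx') hx'
  linarith

end PeriodicRD

open PeriodicRD in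
theorem mainTheorem7 (f : ℝ → ℝ → ℝ) (T : ℝ) (hT : 0 < T)
    (hf : PeriodicRD.IsAdmissible f T)
    (p : ℝ → ℝ) (hp : p ∈ PeriodicRD.XPer f T)
    (hU : ∃ U : ℝ → ℝ → ℝ, PeriodicRD.IsEntireSolution f U ∧
      (∀ x t : ℝ, U x (t + T) = U x t) ∧
      PeriodicRD.IsSymmDecreasing U ∧ PeriodicRD.IsBase U p) :
    p ∉ PeriodicRD.YPer f T := by
  intro hpY
  obtain ⟨U, hsol, hper, ⟨x₀, -, hdec⟩, hbase⟩ := hU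
  obtain ⟨b₁, hb₁, H, hHp, hH⟩ := exists_solution_of_mem_YPer hpY
  obtain ⟨R, K, L, hfam⟩ := hf.exists_solutionFamily hT hb₁.le (fun a ha => (hH a ha).1)
    (fun a ha => (hH a ha).2.1) (fun a ha => (hH a ha).2.2.1)
  have hV : ∀ x t, HasDerivAt (fun y => U y t) (deriv (fun y => U y t) x) x := fun x t =>
    ((hsol.contDiff_x t).differentiable two_ne_zero x).hasDerivAt
  have hV₁ : ∀ x t, HasDerivAt (fun y => deriv (fun z => U z t) y)
      (iteratedDeriv 2 (fun y => U y t) x) x := fun x t => by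
    have h1 : iteratedDeriv 2 (fun y => U y t) = deriv (deriv fun y => U y t) := by
      rw [iteratedDeriv_succ, iteratedDeriv_one]
    rw [h1]
    have h2 : ContDiff ℝ 1 (deriv fun y => U y t) :=
      ((contDiff_succ_iff_deriv (n := 1)).1 (hsol.contDiff_x t)).2.2
    exact (h2.differentiable one_ne_zero x).hasDerivAt
  have hanti : ∀ t, StrictAntiOn (fun x => U x t) (Ici x₀) := fun t =>
    strictAntiOn_of_deriv_neg (convex_Ici x₀) (hsol.contDiff_x t).continuous.continuousOn
      fun x hx => hdec x t (by rwa [interior_Ici] at hx)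
  have hpc : Continuous p := continuous_iff_continuousAt.2 fun t => (hp.2.2 t).continuousAt
  have hmem₁ : b₁ ∈ Icc (p 0) b₁ := ⟨hb₁.le, le_rfl⟩
  obtain ⟨x₁, hx₁, hrange⟩ := exists_forall_lt_of_base (q := H b₁) (x₀ := x₀) (T := T)
    (fun x => (hsol.contDiff_t x).continuous) (fun t => (hanti t).antitoneOn)
    (fun t => (hbase t).1) hpc.continuousOn
    (fun t ht => (hfam.deriv b₁ hmem₁ t ht).continuousWithinAt) (fun t ht => by
      have := hfam.strictMonoOn ht ⟨le_rfl, hb₁.le⟩ hmem₁ hb₁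
      simp only [hHp] at this
      exact this)
  obtain ⟨κ, C, hκc, hκpos, hκC, hκmono, hint⟩ := hfam.exists_weight (U := U)
    (Ut := fun x t => deriv (fun s => U x s) t)
    (D := fun x t => iteratedDeriv 2 (fun y => U y t) x) (x₁ := x₁) hb₁.le
    (fun a ha => (hH a ha).2.2.2) hsol.continuous
    (fun x hx t ht => by rw [hHp]; exact hrange x hx t ht)
    (fun x y t hx hxy => (hanti t).antitoneOn (hx₁.le.trans hx) (hx₁.le.trans (hx.trans hxy)) hxy)
    (fun x => by simpa using hper x 0)
    (fun x t => ((hsol.contDiff_t x).differentiable one_ne_zero t).hasDerivAt)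
    (fun x t => by rw [hsol.equation x t, add_sub_cancel_right]) hsol.continuous_xx
  exact false_of_weight hT hsol.nonneg hV hV₁ hsol.continuous hsol.continuous_x hsol.continuous_xx
    (fun x t hx => hdec x t (hx₁.trans_le hx)) hκc hκpos hκC hκmono hint
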